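/- Let $\mathbb{F}$ be an arbitrary field, and let $V$ be a vector space over $\mathbb{F}$ with (finite or infinite) countable dimension. Let $u$ be a locally nilpotent endomorphism of $V$, i.e. an $\mathbb{F}$-linear map $u : V \to V$ such that for every $x \in V$ there is an integer $n \geq 0$ with $u^n(x) = 0$. Then $u$ is the sum of two square-zero endomorphisms of $V$: there exist $\mathbb{F}$-linear maps $a, b : V \to V$ such that $a^2 = 0$, $b^2 = 0$ and $u = a + b$. -/

import Mathlib

/-- An endomorphism `u` of a vector space is locally nilpotent when every vector is
annihilated by some power of `u` (the exponent may depend on the vector). -/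
def Module.End.IsLocallyNilpotent {F V : Type*} [Field F] [AddCommGroup V] [Module F V]
    (u : Module.End F V) : Prop :=
  ∀ x : V, ∃ n : ℕ, (u ^ n) x = 0

/-!
The theorem follows once `V` is written as a direct sum `A ⊕ B` of two subspaces exchanged by `u`:
then `u` composed with the projection onto `A`, and `u` composed with the projection onto `B`, are
square-zero and add up to `u`.

Such a decomposition is built by the method of Mackey and Kaplansky for Ulm's theorem. Let `V_α` be
the transfinite filtration of `V` by iterated images, with `V_{α+1} = u(V_α)`. A pair `(A, B)` of
disjoint finite-dimensional subspaces exchanged by `u` is *height-compatible* if every `V_α`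
contains the components of those of its elements that lie in `A ⊕ B`. Every such pair can be
enlarged so that the sum contains a given vector `x` (`IsCompatible.exists_extension`); as `V` has
countable dimension, the union of a suitable increasing sequence of pairs is all of `V`.

By local nilpotence we may assume `u x ∈ A ⊕ B`, and three facts give the enlargement.
* A vector `y` with `u y ∈ B`, of maximal height in its coset modulo `A ⊕ B`, can be adjoined to `A`
  (`IsCompatible.sup_span`).
* A vector of `B` of height greater than `β` is, after enlarging `A`, the image of a vector
  of `A` of height at least `β` (`IsCompatible.exists_lift`). Applied to the two components of
  `u x`, this reduces the problem to the case `u x = 0`.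
* If `u x = 0`, let `α` be the largest height in `x + A + B`, attained at `x + w`. If `u w` can be
  chosen of height at least `α + 2`, lifting its components and subtracting the lifts
  from `x + w` gives a kernel vector that can be adjoined. Otherwise `u w` has height exactly
  `α + 1`; lifting its components either makes the former case apply or makes the largest height
  grow. Lifting does not change `u(A + B)`, so the dimension of `u(A + B) ∩ V_{α+1}` drops in the
  latter case, and this can happen only finitely often. Vectors lying in every `V_α` are handled by
  the same lifting, since `u` maps the intersection of the `V_α` onto itself
  (`IsCompatible.exists_extension_of_ker`).
-/

universe v

namespace Module.End

variable {F : Type*} {V : Type v} [Field F] [AddCommGroup V] [Module F V]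

/-! ### The transfinite image filtration -/

/-- The transfinite filtration of `V` by iterated images of `u`: it is `⊤` at `0`, each step applies
`u`, and intersections are taken at limit ordinals. A vector in `u.imageFiltration α` is said to
have height at least `α`. -/
noncomputable def imageFiltration (u : Module.End F V) (α : Ordinal.{v}) : Submodule F V :=
  ⨅ β : Set.Iio α, (imageFiltration u β.1).map u
termination_by α
decreasing_by exact β.2

variable {u : Module.End F V}

theorem mem_imageFiltration {α : Ordinal.{v}} {x : V} :
    x ∈ u.imageFiltration α ↔ ∀ β < α, ∃ y ∈ u.imageFiltration β, u y = x := by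
  rw [imageFiltration]
  simp [Submodule.mem_iInf]

theorem imageFiltration_antitone : Antitone u.imageFiltration := by
  intro α β h x hx
  rw [mem_imageFiltration] at hx ⊢
  exact fun γ hγ => hx γ (hγ.trans_le h)

theorem mem_imageFiltration_zero (x : V) : x ∈ u.imageFiltration 0 := by
  rw [mem_imageFiltration]
  intro β hβ
  exact absurd hβ (not_lt.2 (zero_le (a := β)))

theorem mem_imageFiltration_add_one {α : Ordinal.{v}} {x : V} :
    x ∈ u.imageFiltration (α + 1) ↔ ∃ y ∈ u.imageFiltration α, u y = x := by
  rw [mem_imageFiltration]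
  constructor
  · exact fun h => h α (Order.lt_add_one_iff.2 le_rfl)
  · rintro ⟨y, hy, rfl⟩ β hβ
    exact ⟨y, imageFiltration_antitone (Order.lt_add_one_iff.1 hβ) hy, rfl⟩

theorem apply_mem_imageFiltration {α : Ordinal.{v}} {x : V} (hx : x ∈ u.imageFiltration α) :
    u x ∈ u.imageFiltration (α + 1) :=
  mem_imageFiltration_add_one.2 ⟨x, hx, rfl⟩

/-- The filtration is stationary from some ordinal on, as the ordinals of a universe do not embed
into a type of that universe. -/
theorem exists_imageFiltration_stationary (u : Module.End F V) :
    ∃ θ : Ordinal.{v}, ∀ α, u.imageFiltration θ ≤ u.imageFiltration α := by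
  obtain ⟨α, β, hαβ, hne⟩ : ∃ α β, u.imageFiltration α = u.imageFiltration β ∧ α ≠ β := by
    have := not_injective_of_ordinal u.imageFiltration
    simpa [Function.Injective] using this
  wlog hlt : α < β generalizing α β
  · exact this β α hαβ.symm hne.symm (lt_of_le_of_ne (not_lt.1 hlt) hne.symm)
  refine ⟨α, fun γ => ?_⟩
  induction γ using WellFoundedLT.induction with
  | ind γ ih =>
    intro x hx
    rw [hαβ] at hx
    obtain ⟨y, hy, rfl⟩ := mem_imageFiltration.1 hx α hlt
    exact mem_imageFiltration.2 fun δ hδ => ⟨y, ih δ hδ hy, rfl⟩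

/-- A vector either lies in the whole filtration or has an exact height. -/
theorem forall_mem_or_exists_height (u : Module.End F V) (x : V) :
    (∀ α, x ∈ u.imageFiltration α) ∨
      ∃ α, x ∈ u.imageFiltration α ∧ x ∉ u.imageFiltration (α + 1) := by
  by_contra! h
  obtain ⟨⟨α, hα⟩, h⟩ := h
  refine hα ?_
  induction α using WellFoundedLT.induction with
  | ind α ih =>
    refine mem_imageFiltration.2 fun β hβ => mem_imageFiltration_add_one.1 (h β ?_)
    by_contra hβx
    exact hβx (ih β hβ hβx)

/-- A coset of a finite-dimensional subspace contains a vector of largest height. -/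
theorem exists_height_maximal (u : Module.End F V) (W : Submodule F V) [FiniteDimensional F W]
    (x : V) : ∃ w ∈ W, ∀ w' ∈ W, ∀ α, x + w' ∈ u.imageFiltration α →
      x + w ∈ u.imageFiltration α := by
  by_cases hx : x ∈ W
  · exact ⟨-x, neg_mem hx, fun _ _ α _ => by simp⟩
  -- Among the traces on `W + Fx` that are not contained in `W`, take a minimal one.
  let T := W ⊔ Submodule.span F {x}
  let S : Set (Submodule F T) :=
    {P | ∃ α, P = (u.imageFiltration α).comap T.subtype ∧ ¬ P ≤ W.comap T.subtype}
  have hxT : x ∈ T := Submodule.mem_sup_right (Submodule.mem_span_singleton_self x)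
  have hS : S.Nonempty := by
    refine ⟨_, 0, rfl, fun h => hx ?_⟩
    exact h (show (⟨x, hxT⟩ : T) ∈ _ from mem_imageFiltration_zero x)
  obtain ⟨P, ⟨α, rfl, hα⟩, hmin⟩ :=
    (wellFounded_lt (α := Submodule F T)).has_min S hS
  obtain ⟨⟨y, hyT⟩, hyα, hyW⟩ := SetLike.not_le_iff_exists.1 hα
  obtain ⟨w, hw, z, hz, rfl⟩ := Submodule.mem_sup.1 hyT
  obtain ⟨c, rfl⟩ := Submodule.mem_span_singleton.1 hz
  have hc : c ≠ 0 := by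
    rintro rfl
    exact hyW (by simpa using hw)
  refine ⟨c⁻¹ • w, W.smul_mem _ hw, fun w' hw' β hβ => ?_⟩
  have key : x + c⁻¹ • w ∈ u.imageFiltration α := by
    have := (u.imageFiltration α).smul_mem c⁻¹ hyα
    simpa [smul_add, smul_smul, hc, add_comm] using this
  rcases le_total β α with h | h
  · exact imageFiltration_antitone h key
  · have hxw' : x + w' ∈ T := add_mem hxT (Submodule.mem_sup_left hw')
    have hβS : (u.imageFiltration β).comap T.subtype ∈ S := by
      refine ⟨β, rfl, fun hle => hx ?_⟩
      have : x + w' ∈ W := hle (show (⟨x + w', hxw'⟩ : T) ∈ _ from hβ)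
      exact (Submodule.add_mem_iff_left _ hw').1 this
    have hle : (u.imageFiltration β).comap T.subtype ≤ (u.imageFiltration α).comap T.subtype :=
      Submodule.comap_mono (imageFiltration_antitone h)
    have heq := eq_of_le_of_not_lt hle (hmin _ hβS)
    have hkT : x + c⁻¹ • w ∈ T := add_mem hxT (Submodule.mem_sup_left (W.smul_mem _ hw))
    have : (⟨x + c⁻¹ • w, hkT⟩ : T) ∈ (u.imageFiltration β).comap T.subtype := by
      rw [heq]; exact key
    exact this

/-- Below `δ`, the traces of the filtration on a finite-dimensional subspace are eventually
constant. -/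
theorem exists_trace_constant (u : Module.End F V) (W : Submodule F V) [FiniteDimensional F W]
    {β δ : Ordinal.{v}} (h : β < δ) : ∃ ε, β ≤ ε ∧ ε < δ ∧ ∀ w ∈ W, w ∈ u.imageFiltration ε →
      ∀ γ < δ, w ∈ u.imageFiltration γ := by
  let S : Set (Submodule F W) :=
    {P | ∃ ε, β ≤ ε ∧ ε < δ ∧ P = (u.imageFiltration ε).comap W.subtype}
  obtain ⟨P, ⟨ε, hβ, hδ, rfl⟩, hmin⟩ :=
    (wellFounded_lt (α := Submodule F W)).has_min S ⟨_, β, le_rfl, h, rfl⟩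
  refine ⟨ε, hβ, hδ, fun w hw hwε γ hγ => ?_⟩
  rcases le_total γ ε with h' | h'
  · exact imageFiltration_antitone h' hwε
  · have hle : (u.imageFiltration γ).comap W.subtype ≤ (u.imageFiltration ε).comap W.subtype :=
      Submodule.comap_mono (imageFiltration_antitone h')
    have heq := eq_of_le_of_not_lt hle (hmin _ ⟨γ, hβ.trans h', hγ, rfl⟩)
    have : (⟨w, hw⟩ : W) ∈ (u.imageFiltration γ).comap W.subtype := by
      rw [heq]; exact hwε
    exact this

/-! ### Height-compatible pairs -/

/-- A pair of disjoint finite-dimensional subspaces exchanged by `u`, such that both components of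
an element of their sum have at least the height of that element. -/
structure IsCompatible (u : Module.End F V) (A B : Submodule F V) : Prop where
  finite_left : FiniteDimensional F A
  finite_right : FiniteDimensional F B
  apply_left : ∀ a ∈ A, u a ∈ B
  apply_right : ∀ b ∈ B, u b ∈ A
  disjoint : Disjoint A B
  left_mem : ∀ α, ∀ a ∈ A, ∀ b ∈ B, a + b ∈ u.imageFiltration α → a ∈ u.imageFiltration α

/-- `y` has the largest height among the elements of its coset `y + W`. -/
def IsProper (u : Module.End F V) (W : Submodule F V) (y : V) : Prop :=
  ∀ α, ∀ w ∈ W, y + w ∈ u.imageFiltration α → y ∈ u.imageFiltration α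

namespace IsCompatible

variable {A B : Submodule F V}

theorem right_mem (h : IsCompatible u A B) {α : Ordinal.{v}} {a b : V} (ha : a ∈ A) (hb : b ∈ B)
    (hab : a + b ∈ u.imageFiltration α) : b ∈ u.imageFiltration α :=
  (Submodule.add_mem_iff_right _ (h.left_mem α a ha b hb hab)).1 hab

theorem symm (h : IsCompatible u A B) : IsCompatible u B A where
  finite_left := h.finite_right
  finite_right := h.finite_left
  apply_left := h.apply_right
  apply_right := h.apply_left
  disjoint := h.disjoint.symm
  left_mem _ b hb a ha hab := h.right_mem ha hb (by rwa [add_comm])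

theorem finite_sup (h : IsCompatible u A B) : FiniteDimensional F ↥(A ⊔ B) :=
  have := h.finite_left
  have := h.finite_right
  inferInstance

theorem bot (u : Module.End F V) : IsCompatible u ⊥ ⊥ where
  finite_left := inferInstance
  finite_right := inferInstance
  apply_left a ha := by simp_all
  apply_right a ha := by simp_all
  disjoint := disjoint_bot_left
  left_mem α a ha b hb _ := by simp_all

/-- A proper vector may be adjoined to the component opposite to the one containing its image. -/
theorem sup_span (h : IsCompatible u A B) {y : V} (hy : IsProper u (A ⊔ B) y) (hyAB : y ∉ A ⊔ B)
    (huy : u y ∈ B) : IsCompatible u (A ⊔ Submodule.span F {y}) B where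
  finite_left := by
    have := h.finite_left
    infer_instance
  finite_right := h.finite_right
  apply_left x hx := by
    obtain ⟨a, ha, z, hz, rfl⟩ := Submodule.mem_sup.1 hx
    obtain ⟨c, rfl⟩ := Submodule.mem_span_singleton.1 hz
    rw [map_add, map_smul]
    exact add_mem (h.apply_left a ha) (B.smul_mem c huy)
  apply_right b hb := Submodule.mem_sup_left (h.apply_right b hb)
  disjoint := by
    rw [Submodule.disjoint_def]
    intro x hx hxB
    obtain ⟨a, ha, z, hz, rfl⟩ := Submodule.mem_sup.1 hx
    obtain ⟨c, rfl⟩ := Submodule.mem_span_singleton.1 hz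
    have hcy : c • y ∈ A ⊔ B :=
      (Submodule.add_mem_iff_right _ (Submodule.mem_sup_left ha)).1 (Submodule.mem_sup_right hxB)
    have hc : c = 0 := by
      by_contra hc
      exact hyAB ((Submodule.smul_mem_iff _ hc).1 hcy)
    subst hc
    rw [zero_smul, add_zero] at hxB ⊢
    exact Submodule.disjoint_def.1 h.disjoint a ha hxB
  left_mem α x hx b hb hxb := by
    obtain ⟨a, ha, z, hz, rfl⟩ := Submodule.mem_sup.1 hx
    obtain ⟨c, rfl⟩ := Submodule.mem_span_singleton.1 hz
    have hab : a + b ∈ A ⊔ B := Submodule.add_mem_sup ha hb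
    have hcy : c • y ∈ u.imageFiltration α := by
      rcases eq_or_ne c 0 with rfl | hc
      · simp
      · refine Submodule.smul_mem _ c (hy α (c⁻¹ • (a + b)) (Submodule.smul_mem _ _ hab) ?_)
        rw [← Submodule.smul_mem_iff _ hc, smul_add, smul_inv_smul₀ hc]
        convert hxb using 1
        abel
    refine add_mem (h.left_mem α a ha b hb ?_) hcy
    rw [← Submodule.add_mem_iff_left _ hcy]
    convert hxb using 1
    abel

/-- A vector `b` of `B` of height at least `β + 1`, chosen of largest height modulo the images of
the vectors of `A` of height at least `β`, has a proper preimage of height at least `β`. -/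
theorem exists_proper_preimage (h : IsCompatible u A B) {β : Ordinal.{v}} {b : V} (hb : b ∈ B)
    (hbβ : b ∈ u.imageFiltration (β + 1))
    (hmax : ∀ a ∈ A, a ∈ u.imageFiltration β → ∀ γ, b + u a ∈ u.imageFiltration γ →
      b ∈ u.imageFiltration γ) :
    ∃ y ∈ u.imageFiltration β, u y = b ∧ IsProper u (A ⊔ B) y := by
  rcases forall_mem_or_exists_height u b with hb' | ⟨δ, hδ, hδ'⟩
  · obtain ⟨θ, hθ⟩ := exists_imageFiltration_stationary u
    obtain ⟨y, hy, hyb⟩ := mem_imageFiltration_add_one.1 (hb' (θ + 1))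
    exact ⟨y, hθ β hy, hyb, fun α _ _ _ => hθ α hy⟩
  · have hβδ : β < δ := by
      by_contra! hle
      exact hδ' (imageFiltration_antitone (by gcongr) hbβ)
    -- The preimage is taken of height beyond which `A ⊔ B` has no heights below `δ`.
    have := h.finite_sup
    obtain ⟨ε, hβε, hεδ, hε⟩ := exists_trace_constant u (A ⊔ B) hβδ
    obtain ⟨y, hy, hyb⟩ := mem_imageFiltration.1 hδ ε hεδ
    refine ⟨y, imageFiltration_antitone hβε hy, hyb, fun α w hw hyw => ?_⟩
    rcases le_total α ε with hα | hα
    · exact imageFiltration_antitone hα hy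
    have hwε : w ∈ u.imageFiltration ε :=
      (Submodule.add_mem_iff_right _ hy).1 (imageFiltration_antitone hα hyw)
    rcases lt_or_ge α δ with hαδ | hαδ
    · exact (Submodule.add_mem_iff_left _ (hε w hw hwε α hαδ)).1 hyw
    · exfalso
      obtain ⟨p, hp, q, hq, rfl⟩ := Submodule.mem_sup.1 hw
      have h1 := apply_mem_imageFiltration (imageFiltration_antitone hαδ hyw)
      rw [map_add, map_add, hyb, ← add_assoc] at h1
      have h2 : b + u p ∈ u.imageFiltration (δ + 1) :=
        h.symm.left_mem _ _ (add_mem hb (h.apply_left p hp)) _ (h.apply_right q hq) h1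
      exact hδ' (hmax p hp (imageFiltration_antitone hβε (h.left_mem _ p hp q hq hwε)) _ h2)

/-- After enlarging `A` by vectors of height at least `β`, a vector of `B` of height at least
`β + 1` has a preimage in `A` of height at least `β`. -/
theorem exists_lift (h : IsCompatible u A B) {β : Ordinal.{v}} {b : V} (hb : b ∈ B)
    (hbβ : b ∈ u.imageFiltration (β + 1)) :
    ∃ A', A ≤ A' ∧ IsCompatible u A' B ∧ A' ≤ A ⊔ u.imageFiltration β ∧
      A'.map u ≤ A.map u ⊔ Submodule.span F {b} ∧ ∃ y ∈ A', y ∈ u.imageFiltration β ∧ u y = b := by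
  have := h.finite_left
  have : FiniteDimensional F ↥(A ⊓ u.imageFiltration β) :=
    Submodule.finiteDimensional_of_le inf_le_left
  obtain ⟨_, ⟨a, ⟨haA, haβ⟩, rfl⟩, hmax⟩ :=
    exists_height_maximal u ((A ⊓ u.imageFiltration β).map u) b
  have hbB : b + u a ∈ B := add_mem hb (h.apply_left a haA)
  obtain ⟨y, hyβ, hy, hproper⟩ := h.exists_proper_preimage (β := β) hbB
    (add_mem hbβ (apply_mem_imageFiltration haβ)) (by
      intro a' ha' ha'β γ hγ
      refine hmax (u (a + a')) ⟨a + a', ⟨add_mem haA ha', add_mem haβ ha'β⟩, rfl⟩ γ ?_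
      rwa [map_add, ← add_assoc])
  by_cases hyAB : y ∈ A ⊔ B
  · obtain ⟨p, hp, q, hq, rfl⟩ := Submodule.mem_sup.1 hyAB
    have huq : u q = 0 := by
      refine Submodule.disjoint_def.1 h.disjoint _ (h.apply_right q hq) ?_
      rw [map_add] at hy
      exact (Submodule.add_mem_iff_right _ (h.apply_left p hp)).1 (hy ▸ hbB)
    refine ⟨A, le_rfl, h, le_sup_left, le_sup_left, p - a, sub_mem hp haA,
      sub_mem (h.left_mem β p hp q hq hyβ) haβ, ?_⟩
    rw [map_add, huq, add_zero] at hy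
    rw [map_sub, hy, add_sub_cancel_right]
  · refine ⟨A ⊔ Submodule.span F {y}, le_sup_left, h.sup_span hproper hyAB (hy ▸ hbB), ?_, ?_,
      y - a, ?_, sub_mem hyβ haβ, by rw [map_sub, hy, add_sub_cancel_right]⟩
    · refine sup_le_sup_left ?_ A
      rwa [Submodule.span_singleton_le_iff_mem]
    · rw [Submodule.map_sup, Submodule.map_span, Set.image_singleton, hy]
      refine sup_le le_sup_left ?_
      rw [Submodule.span_singleton_le_iff_mem, add_comm]
      exact Submodule.add_mem_sup ⟨a, haA, rfl⟩ (Submodule.mem_span_singleton_self b)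
    · exact sub_mem (Submodule.mem_sup_right (Submodule.mem_span_singleton_self y))
        (Submodule.mem_sup_left haA)

/-- Both components of a vector `u w` of height at least `β + 1` can be lifted simultaneously to
vectors of height at least `β`, without enlarging the image `u (A + B)`. -/
theorem exists_lift_apply (h : IsCompatible u A B) {β : Ordinal.{v}} {w : V} (hw : w ∈ A ⊔ B)
    (hwβ : u w ∈ u.imageFiltration (β + 1)) :
    ∃ A' B', A ≤ A' ∧ B ≤ B' ∧ IsCompatible u A' B' ∧ A' ⊔ B' ≤ A ⊔ B ⊔ u.imageFiltration β ∧
      (A' ⊔ B').map u ≤ (A ⊔ B).map u ∧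
      ∃ y ∈ A' ⊔ B', y ∈ u.imageFiltration β ∧ u y = u w := by
  obtain ⟨p, hp, q, hq, rfl⟩ := Submodule.mem_sup.1 hw
  rw [map_add] at hwβ
  have hup := h.symm.left_mem _ _ (h.apply_left p hp) _ (h.apply_right q hq) hwβ
  have huq := h.symm.right_mem (h.apply_left p hp) (h.apply_right q hq) hwβ
  obtain ⟨A', hA, hc, hA', hmA, y, hyA, hyβ, hy⟩ := h.exists_lift (h.apply_left p hp) hup
  obtain ⟨B', hB, hc', hB', hmB, z, hzB, hzβ, hz⟩ :=
    hc.symm.exists_lift (hA (h.apply_right q hq)) huq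
  refine ⟨A', B', hA, hB, hc'.symm, ?_, ?_, y + z, Submodule.add_mem_sup hyA hzB,
    add_mem hyβ hzβ, by rw [map_add, map_add, hy, hz]⟩
  · exact sup_le (hA'.trans (sup_le_sup_right le_sup_left _))
      (hB'.trans (sup_le_sup_right le_sup_right _))
  · rw [Submodule.map_sup, Submodule.map_sup]
    refine sup_le (hmA.trans (sup_le le_sup_left ?_)) (hmB.trans (sup_le le_sup_right ?_))
    · rw [Submodule.span_singleton_le_iff_mem]
      exact Submodule.mem_sup_left ⟨p, hp, rfl⟩
    · rw [Submodule.span_singleton_le_iff_mem]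
      exact Submodule.mem_sup_right ⟨q, hq, rfl⟩

/-! ### Enlarging a compatible pair -/

theorem exists_extension_of_proper (h : IsCompatible u A B) {z : V} (hz : IsProper u (A ⊔ B) z)
    (huz : u z = 0) : ∃ A', A ≤ A' ∧ IsCompatible u A' B ∧ z ∈ A' ⊔ B := by
  by_cases hzAB : z ∈ A ⊔ B
  · exact ⟨A, le_rfl, h, hzAB⟩
  · exact ⟨_, le_sup_left, h.sup_span hz hzAB (huz ▸ B.zero_mem),
      Submodule.mem_sup_left (Submodule.mem_sup_right (Submodule.mem_span_singleton_self z))⟩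

/-- A kernel vector `x` can be adjoined as soon as, for some `w` in `A ⊔ B` with `u w` of height at
least `β + 1`, the vector `x + w` is proper and remains so after adding vectors of height at least
`β` to it and to `A ⊔ B`. -/
theorem exists_extension_of_ker_of_proper (h : IsCompatible u A B) {β : Ordinal.{v}} {x w : V}
    (hx : u x = 0) (hw : w ∈ A ⊔ B) (hwβ : u w ∈ u.imageFiltration (β + 1))
    (hproper : ∀ y ∈ u.imageFiltration β,
      IsProper u (A ⊔ B ⊔ u.imageFiltration β) (x + w - y)) :
    ∃ A' B', A ≤ A' ∧ B ≤ B' ∧ IsCompatible u A' B' ∧ x ∈ A' ⊔ B' := by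
  obtain ⟨A', B', hA, hB, hc, hle, -, y, hy, hyβ, huy⟩ := h.exists_lift_apply hw hwβ
  obtain ⟨A'', hA', hc', hz⟩ := hc.exists_extension_of_proper (z := x + w - y)
    (fun α w' hw' => hproper y hyβ α w' (hle hw')) (by rw [map_sub, map_add, hx, huy]; simp)
  refine ⟨A'', B', hA.trans hA', hB, hc', ?_⟩
  have hy' : y ∈ A'' ⊔ B' := sup_le_sup_right hA' _ hy
  have hw' : w ∈ A'' ⊔ B' := sup_le_sup (hA.trans hA') hB hw
  have := sub_mem (add_mem hz hy') hw'
  simpa using this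

/-- The case of a kernel vector whose coset modulo `A ⊔ B` meets every term of the filtration. -/
theorem exists_extension_of_ker_of_forall_mem (h : IsCompatible u A B) {x w : V}
    (hx : u x = 0) (hw : w ∈ A ⊔ B) (hxw : ∀ α, x + w ∈ u.imageFiltration α) :
    ∃ A' B', A ≤ A' ∧ B ≤ B' ∧ IsCompatible u A' B' ∧ x ∈ A' ⊔ B' := by
  obtain ⟨θ, hθ⟩ := exists_imageFiltration_stationary u
  refine h.exists_extension_of_ker_of_proper (β := θ) hx hw ?_ fun y hy α _ _ _ =>
    hθ α (sub_mem (hxw θ) hy)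
  have := apply_mem_imageFiltration (hxw θ)
  rwa [map_add, hx, zero_add] at this

/-- The case of a kernel vector `x` whose coset modulo `A ⊔ B` has largest height exactly `α`,
attained at `x + w` with `u w` of height at least `α + 2`: the components of `u w` have lifts of
height at least `α + 1`, and these do not affect the largest height. -/
theorem exists_extension_of_ker_of_height (h : IsCompatible u A B) {α : Ordinal.{v}} {x w : V}
    (hx : u x = 0) (hw : w ∈ A ⊔ B) (hxw : x + w ∈ u.imageFiltration α)
    (hmax : ∀ w' ∈ A ⊔ B, x + w' ∉ u.imageFiltration (α + 1))
    (huw : u w ∈ u.imageFiltration (α + 1 + 1)) :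
    ∃ A' B', A ≤ A' ∧ B ≤ B' ∧ IsCompatible u A' B' ∧ x ∈ A' ⊔ B' := by
  refine h.exists_extension_of_ker_of_proper (β := α + 1) hx hw huw fun y hy γ w' hw' hγ => ?_
  rcases le_or_gt γ α with hle | hlt
  · exact imageFiltration_antitone hle (sub_mem hxw (imageFiltration_antitone le_self_add hy))
  · exfalso
    obtain ⟨w₁, hw₁, v, hv, rfl⟩ := Submodule.mem_sup.1 hw'
    refine hmax (w + w₁) (add_mem hw hw₁) ?_
    have := imageFiltration_antitone (Order.add_one_le_of_lt hlt) hγ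
    convert add_mem (sub_mem this hv) hy using 1
    abel

/-- A vector of the kernel lies in the sum of a larger compatible pair. The induction is on the
dimension of the part of `u (A + B)` of height greater than the largest height `α` of the coset. -/
theorem exists_extension_of_ker (h : IsCompatible u A B) {x : V} (hx : u x = 0) :
    ∃ A' B', A ≤ A' ∧ B ≤ B' ∧ IsCompatible u A' B' ∧ x ∈ A' ⊔ B' := by
  have := h.finite_sup
  obtain ⟨w, hw, hmax⟩ := exists_height_maximal u (A ⊔ B) x
  rcases forall_mem_or_exists_height u (x + w) with hxw | ⟨α, hα, hα'⟩
  · exact h.exists_extension_of_ker_of_forall_mem hx hw hxw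
  induction hn : Module.finrank F ↥((A ⊔ B).map u ⊓ u.imageFiltration (α + 1))
    using Nat.strong_induction_on generalizing A B α w with
  | _ n ih =>
  subst hn
  have hmax' : ∀ w' ∈ A ⊔ B, x + w' ∉ u.imageFiltration (α + 1) :=
    fun w' hw' hm => hα' (hmax w' hw' _ hm)
  by_cases huw : u w ∈ u.imageFiltration (α + 1 + 1)
  · exact h.exists_extension_of_ker_of_height hx hw hα hmax' huw
  have huw' : u w ∈ u.imageFiltration (α + 1) := by
    have := apply_mem_imageFiltration hα
    rwa [map_add, hx, zero_add] at this
  obtain ⟨A', B', hA, hB, hc, -, hmap, y, hy, hyα, huy⟩ := h.exists_lift_apply hw huw'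
  have hwy : w - y ∈ A' ⊔ B' := sub_mem (sup_le_sup hA hB hw) hy
  suffices ∃ A'' B'', A' ≤ A'' ∧ B' ≤ B'' ∧ IsCompatible u A'' B'' ∧ x ∈ A'' ⊔ B'' by
    obtain ⟨A'', B'', hA', hB', h'⟩ := this
    exact ⟨A'', B'', hA.trans hA', hB.trans hB', h'⟩
  by_cases hbig : ∃ w' ∈ A' ⊔ B', x + w' ∈ u.imageFiltration (α + 1)
  · obtain ⟨w₁, hw₁, hw₁α⟩ := hbig
    have := hc.finite_sup
    obtain ⟨w₂, hw₂, hmax₂⟩ := exists_height_maximal u (A' ⊔ B') x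
    rcases forall_mem_or_exists_height u (x + w₂) with hxw | ⟨γ, hγ, hγ'⟩
    · exact hc.exists_extension_of_ker_of_forall_mem hx hw₂ hxw
    have hαγ : α + 1 ≤ γ := by
      by_contra! hlt
      exact hγ' (imageFiltration_antitone (Order.add_one_le_of_lt hlt) (hmax₂ w₁ hw₁ _ hw₁α))
    -- The vector `u w` of height exactly `α + 1` is lost from the intersection.
    refine ih _ (Submodule.finrank_lt_finrank_of_lt (SetLike.lt_iff_le_and_exists.2
      ⟨inf_le_inf hmap (imageFiltration_antitone (hαγ.trans le_self_add)),
        u w, ⟨⟨w, hw, rfl⟩, huw'⟩, fun hmem => huw ?_⟩)) hc hc.finite_sup w₂ hw₂ hmax₂ γ hγ hγ' rfl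
    exact imageFiltration_antitone (by gcongr) hmem.2
  -- Otherwise the largest height is still `α`, now attained at the kernel vector `x + (w - y)`.
  · push Not at hbig
    refine hc.exists_extension_of_ker_of_height hx hwy ?_ hbig ?_
    · rw [← add_sub_assoc]
      exact sub_mem hα hyα
    · rw [map_sub, huy, sub_self]
      exact zero_mem _

theorem exists_extension_of_apply_mem (h : IsCompatible u A B) {x : V} (hx : u x ∈ A ⊔ B) :
    ∃ A' B', A ≤ A' ∧ B ≤ B' ∧ IsCompatible u A' B' ∧ x ∈ A' ⊔ B' := by
  obtain ⟨p, hp, q, hq, hpq⟩ := Submodule.mem_sup.1 hx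
  have hux : p + q ∈ u.imageFiltration (0 + 1) :=
    hpq ▸ apply_mem_imageFiltration (mem_imageFiltration_zero x)
  obtain ⟨B₁, hB, hc, -, -, y, hy, -, huy⟩ := h.symm.exists_lift hp (h.left_mem _ p hp q hq hux)
  obtain ⟨A₁, hA, hc', -, -, z, hz, -, huz⟩ :=
    hc.symm.exists_lift (hB hq) (h.right_mem hp hq hux)
  obtain ⟨A', B', hA', hB', hc'', hmem⟩ := hc'.exists_extension_of_ker (x := x - (z + y))
    (by rw [map_sub, map_add, huy, huz, ← hpq, add_comm q, sub_self])
  refine ⟨A', B', hA.trans hA', hB.trans hB', hc'', ?_⟩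
  have := add_mem hmem (Submodule.add_mem_sup (hA' hz) (hB' hy))
  rwa [sub_add_cancel] at this

theorem exists_extension (hu : u.IsLocallyNilpotent) (h : IsCompatible u A B) (x : V) :
    ∃ A' B', A ≤ A' ∧ B ≤ B' ∧ IsCompatible u A' B' ∧ x ∈ A' ⊔ B' := by
  obtain ⟨n, hn⟩ := hu x
  induction n generalizing x with
  | zero => exact ⟨A, B, le_rfl, le_rfl, h, by simp_all⟩
  | succ n ih =>
    obtain ⟨A₁, B₁, hA, hB, hc, hx⟩ := ih (u x) (by rwa [pow_succ] at hn)
    obtain ⟨A', B', hA', hB', hc', hx'⟩ := hc.exists_extension_of_apply_mem hx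
    exact ⟨A', B', hA.trans hA', hB.trans hB', hc', hx'⟩

end IsCompatible

/-! ### The decomposition of the whole space -/

/-- A locally nilpotent endomorphism of a space of countable dimension exchanges the two summands
of some direct sum decomposition. -/
theorem IsLocallyNilpotent.exists_isCompl (hu : u.IsLocallyNilpotent)
    (hV : Module.rank F V ≤ Cardinal.aleph0) :
    ∃ A B : Submodule F V, IsCompl A B ∧ (∀ a ∈ A, u a ∈ B) ∧ ∀ b ∈ B, u b ∈ A := by
  obtain ⟨e, he⟩ : ∃ e : ℕ → V, Submodule.span F (Set.range e) = ⊤ := by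
    let b := Module.Basis.ofVectorSpace F V
    have : Countable (Module.Basis.ofVectorSpaceIndex F V) := by
      rw [← Cardinal.mk_le_aleph0_iff, b.mk_eq_rank'']
      exact hV
    obtain ⟨e, he⟩ := ((Set.countable_range b).insert 0).exists_eq_range (Set.insert_nonempty _ _)
    refine ⟨e, ?_⟩
    rw [← he, Submodule.span_insert_zero, b.span_eq]
  let S := {P : Submodule F V × Submodule F V // IsCompatible u P.1 P.2}
  have step : ∀ (P : S) (x : V), ∃ Q : S, P.1 ≤ Q.1 ∧ x ∈ Q.1.1 ⊔ Q.1.2 := by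
    rintro ⟨⟨A, B⟩, h⟩ x
    obtain ⟨A', B', hA, hB, hc, hx⟩ := h.exists_extension hu x
    exact ⟨⟨(A', B'), hc⟩, ⟨hA, hB⟩, hx⟩
  choose next hle hmem using step
  let P : ℕ → S := fun n => Nat.rec ⟨(⊥, ⊥), .bot u⟩ (fun n Q => next Q (e n)) n
  have hP : Monotone fun n => (P n).1 := monotone_nat_of_le_succ fun n => hle (P n) (e n)
  have hP₁ : Monotone fun n => (P n).1.1 := fun m n h => (hP h).1
  have hP₂ : Monotone fun n => (P n).1.2 := fun m n h => (hP h).2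
  refine ⟨⨆ n, (P n).1.1, ⨆ n, (P n).1.2, ⟨?_, ?_⟩, fun a ha => ?_, fun b hb => ?_⟩
  · rw [Submodule.disjoint_def]
    intro x hx₁ hx₂
    obtain ⟨m, hm⟩ := (Submodule.mem_iSup_of_directed _ hP₁.directed_le).1 hx₁
    obtain ⟨n, hn⟩ := (Submodule.mem_iSup_of_directed _ hP₂.directed_le).1 hx₂
    exact Submodule.disjoint_def.1 (P (max m n)).2.disjoint x (hP₁ (le_max_left m n) hm)
      (hP₂ (le_max_right m n) hn)
  · rw [codisjoint_iff, eq_top_iff, ← he, Submodule.span_le]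
    rintro _ ⟨n, rfl⟩
    exact sup_le_sup (le_iSup (fun n => (P n).1.1) (n + 1)) (le_iSup (fun n => (P n).1.2) (n + 1))
      (hmem (P n) (e n))
  · obtain ⟨m, hm⟩ := (Submodule.mem_iSup_of_directed _ hP₁.directed_le).1 ha
    exact Submodule.mem_iSup_of_mem m ((P m).2.apply_left a hm)
  · obtain ⟨m, hm⟩ := (Submodule.mem_iSup_of_directed _ hP₂.directed_le).1 hb
    exact Submodule.mem_iSup_of_mem m ((P m).2.apply_right b hm)

/-- If `u` maps `A` into a complement `B` of `A`, then `u` composed with the projection onto `A`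
along `B` is square-zero. -/
theorem sq_comp_projection_eq_zero {A B : Submodule F V} (h : IsCompl A B)
    (hu : ∀ a ∈ A, u a ∈ B) : (u * A.projection B h) ^ 2 = 0 := by
  ext x
  have hx : u (A.projection B h x) ∈ B := hu _ (Submodule.projection_apply_mem h x)
  simp [pow_two, (Submodule.projection_apply_eq_zero_iff h).2 hx]

end Module.End

theorem mainTheorem3 {F V : Type*} [Field F] [AddCommGroup V] [Module F V]
    (hV : Module.rank F V ≤ Cardinal.aleph0) (u : Module.End F V)
    (hu : u.IsLocallyNilpotent) :
    ∃ a b : Module.End F V, a ^ 2 = 0 ∧ b ^ 2 = 0 ∧ u = a + b := by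
  obtain ⟨A, B, h, hA, hB⟩ := hu.exists_isCompl hV
  refine ⟨u * A.projection B h, u * B.projection A h.symm,
    Module.End.sq_comp_projection_eq_zero h hA, Module.End.sq_comp_projection_eq_zero h.symm hB, ?_⟩
  ext x
  simp [← map_add, Submodule.projection_add_projection_eq_self]
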